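/- Let $S$ and $T$ be finite sets and let $(s_i)_{i\in S}$, $(t_j)_{j\in T}$ be nonnegative integers with $\sum_{i\in S}s_i=\sum_{j\in T}t_j=:N$. The pure constant fixed charge transportation (PCFCT) problem for this instance asks for reals $x_{ij}\ge 0$, $(i,j)\in S\times T$, with $\sum_{j\in T}x_{ij}=s_i$ for all $i\in S$ and $\sum_{i\in S}x_{ij}=t_j$ for all $j\in T$, such that the value $|\{(i,j)\in S\times T: x_{ij}>0\}|$ is minimum. Put $n=|S|+|T|$, index the coordinates of $\mathbb{R}^n$ by the disjoint union $S\sqcup T$, and define $\mathbf{a},\mathbf{b}\in\mathbb{N}^n$ by $a_i=s_i,\ b_i=0$ for $i\in S$ and $a_j=0,\ b_j=t_j$ for $j\in T$. Let $l_k=\min\{a_k,b_k\}$, $u_k=\max\{a_k,b_k\}$ and \[ P=\Big\{\mathbf{x}\in\mathbb{R}^n:\ l_k\le x_k\le u_k \text{ for all } k,\ \sum_k x_k=N\Big\}. \] Then $\mathbf{a}$ and $\mathbf{b}$ are vertices of $P$, they are joined by a path on the skeleton of $P$ (the graph formed by the vertices and edges of $P$), the PCFCT instance has an optimal solution, and the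 length (number of edges) of a shortest path from $\mathbf{a}$ to $\mathbf{b}$ on the skeleton of $P$ is equal to the value of an optimal solution. If moreover all $s_i$ and $t_j$ are positive, then this common number is $|S|+|T|-m$, where $m$ is the maximum size of a same-sum partition of $S$ and $T$. Here a same-sum partition of size $m$ is a collection of pairs $(S_\ell,T_\ell)$, $\ell=1,\dots,m$, of nonempty sets $S_\ell\subseteq S$, $T_\ell\subseteq T$ such that $\{S_\ell\}$ is a partition of $S$, $\{T_\ell\}$ is a partition of $T$, and $\sum_{i\in S_\ell}s_i=\sum_{j\in T_\ell}t_j$ for each $\ell$. -/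

import Mathlib

/-- An instance of the shortest path problem on a box: two vectors `a, b` of natural numbers, with
coordinates indexed by a finite set `ι`, having the same coordinate sum. -/
structure BoxInstance (ι : Type*) [Fintype ι] where
  a : ι → ℕ
  b : ι → ℕ
  sum_eq : ∑ i, a i = ∑ i, b i

namespace BoxInstance

variable {ι : Type*} [Fintype ι] (Q : BoxInstance ι)

/-- The common coordinate sum `N` of `a` and `b`. -/
def total : ℕ := ∑ i, Q.a i

/-- The vector `l` of coordinatewise minima of `a` and `b`. -/
def lower (i : ι) : ℕ := min (Q.a i) (Q.b i)

/-- The vector `u` of coordinatewise maxima of `a` and `b`. -/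
def upper (i : ι) : ℕ := max (Q.a i) (Q.b i)

/-- The polytope `P = {x : l ≤ x ≤ u, ∑ i, x i = N}`. -/
def polytope : Set (ι → ℝ) :=
  {x | (∀ i, (Q.lower i : ℝ) ≤ x i ∧ x i ≤ (Q.upper i : ℝ)) ∧ ∑ i, x i = (Q.total : ℝ)}

/-- The vertices of the polytope. -/
def Vertex : Type _ := {x : ι → ℝ // x ∈ Set.extremePoints ℝ Q.polytope}

/-- The skeleton (1-skeleton) of the polytope: two distinct vertices are adjacent when the segment
joining them is a face of the polytope, i.e. the set of maximizers of a linear functional. -/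
def skeleton : SimpleGraph Q.Vertex where
  Adj x y := x ≠ y ∧ IsExposed ℝ Q.polytope (segment ℝ x.1 y.1)
  symm := ⟨fun x y h => ⟨h.1.symm, by rw [segment_symm]; exact h.2⟩⟩
  loopless := ⟨fun _ h => h.1 rfl⟩

/-- A point of the polytope each of whose coordinates is at one of its bounds is a vertex. -/
theorem mem_extremePoints_of_corner {x : ι → ℝ} (hx : x ∈ Q.polytope)
    (hc : ∀ i, x i = (Q.lower i : ℝ) ∨ x i = (Q.upper i : ℝ)) :
    x ∈ Set.extremePoints ℝ Q.polytope := by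
  rw [mem_extremePoints]
  refine ⟨hx, ?_⟩
  rintro y hy z hz ⟨p, q, hp, hq, hpq, h⟩
  have key : ∀ i, y i = x i ∧ z i = x i := by
    intro i
    have hi : p * y i + q * z i = x i := by simpa using congrFun h i
    have h1 := hy.1 i
    have h2 := hz.1 i
    have e : p * (y i - x i) + q * (z i - x i) = 0 := by linear_combination hi - x i * hpq
    rcases hc i with c | c
    · have y0 : 0 ≤ y i - x i := by linarith
      have z0 : 0 ≤ z i - x i := by linarith
      have py := mul_nonneg hp.le y0
      have qz := mul_nonneg hq.le z0
      have ey : p * (y i - x i) = 0 := by linarith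
      have ez : q * (z i - x i) = 0 := by linarith
      exact ⟨sub_eq_zero.1 ((mul_eq_zero.1 ey).resolve_left hp.ne'),
        sub_eq_zero.1 ((mul_eq_zero.1 ez).resolve_left hq.ne')⟩
    · have y0 : y i - x i ≤ 0 := by linarith
      have z0 : z i - x i ≤ 0 := by linarith
      have py := mul_nonpos_of_nonneg_of_nonpos hp.le y0
      have qz := mul_nonpos_of_nonneg_of_nonpos hq.le z0
      have ey : p * (y i - x i) = 0 := by linarith
      have ez : q * (z i - x i) = 0 := by linarith
      exact ⟨sub_eq_zero.1 ((mul_eq_zero.1 ey).resolve_left hp.ne'),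
        sub_eq_zero.1 ((mul_eq_zero.1 ez).resolve_left hq.ne')⟩
  exact ⟨funext fun i => (key i).1, funext fun i => (key i).2⟩

/-- The vector `a`, as a vertex of the polytope. -/
def source : Q.Vertex :=
  ⟨fun i => (Q.a i : ℝ), Q.mem_extremePoints_of_corner
    ⟨fun i => ⟨by simp [lower], by simp [upper]⟩, by simp [total]⟩
    fun i => by
      rcases le_total (Q.a i) (Q.b i) with h | h
      · left; simp [lower, h]
      · right; simp [upper, h]⟩

/-- The vector `b`, as a vertex of the polytope. -/
def target : Q.Vertex :=
  ⟨fun i => (Q.b i : ℝ), Q.mem_extremePoints_of_corner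
    ⟨fun i => ⟨by simp [lower], by simp [upper]⟩, by simp [total, Q.sum_eq]⟩
    fun i => by
      rcases le_total (Q.a i) (Q.b i) with h | h
      · right; simp [upper, h]
      · left; simp [lower, h]⟩

end BoxInstance

/-- An instance of the pure constant fixed charge transportation problem: supplies `s` on a finite
set `S` and demands `t` on a finite set `T` with the same total. They are natural numbers, since a
negative supply or demand makes the problem infeasible. -/
structure PCFCT (S T : Type*) [Fintype S] [Fintype T] where
  s : S → ℕ
  t : T → ℕ
  sum_eq : ∑ i, s i = ∑ j, t j

namespace PCFCT

variable {S T : Type*} [Fintype S] [Fintype T] (I : PCFCT S T)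

/-- Feasible solutions: nonnegative reals `x i j` meeting all supplies and demands. -/
structure IsSolution (x : S → T → ℝ) : Prop where
  nonneg : ∀ i j, 0 ≤ x i j
  supply : ∀ i, ∑ j, x i j = (I.s i : ℝ)
  demand : ∀ j, ∑ i, x i j = (I.t j : ℝ)

/-- The value of a solution: the number of pairs `(i, j)` with `x i j > 0`. -/
noncomputable def value (x : S → T → ℝ) : ℕ := {p : S × T | 0 < x p.1 p.2}.ncard

/-- The number `d` is the value of an optimal solution. -/
def IsOptimalValue (d : ℕ) : Prop :=
  IsLeast {k | ∃ x : S → T → ℝ, I.IsSolution x ∧ value x = k} d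

/-- The pairs `(A l, B l)`, for `l < m`, form a same-sum partition of size `m`. -/
structure IsSameSumPartition {m : ℕ} (A : Fin m → Finset S) (B : Fin m → Finset T) : Prop where
  nonempty_left : ∀ l, (A l).Nonempty
  nonempty_right : ∀ l, (B l).Nonempty
  partition_left : ∀ i : S, ∃! l, i ∈ A l
  partition_right : ∀ j : T, ∃! l, j ∈ B l
  sum_eq : ∀ l, ∑ i ∈ A l, I.s i = ∑ j ∈ B l, I.t j

/-- The number `m` is the maximum size of a same-sum partition. -/
def IsMaxPartitionSize (m : ℕ) : Prop :=
  IsGreatest {k | ∃ (A : Fin k → Finset S) (B : Fin k → Finset T), I.IsSameSumPartition A B} m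

/-- The converted instance, with coordinates indexed by the disjoint union of `S` and `T`:
`a = (s, 0)` and `b = (0, t)`. -/
def toBox : BoxInstance (S ⊕ T) where
  a := Sum.elim I.s (fun _ => 0)
  b := Sum.elim (fun _ => 0) I.t
  sum_eq := by simp [I.sum_eq]

end PCFCT

/-!
Every quantity in the theorem is computed from the balanced labellings of the places, i.e. of the
`n = |S| + |T|` elements of `S ⊕ T`: labellings such that in every class the supplies and the demands
have the same sum. If `M` is the largest number of classes of a balanced labelling, then both the
optimal value and the distance from `a` to `b` are `n - M`.

* Lower bounds. A solution with `k` positive entries gives `k` pairs of places, namely its support; a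
  walk with `k` steps also gives `k` pairs, because adjacent vertices differ in at most two
  coordinates (`BoxInstance.exists_pair_of_adj`). Merging the labels along these pairs, starting from
  `n` different labels, leaves at least `n - k` of them (`exists_labelling_of_pairs`), and the result
  is balanced since the solution, or the walk, moves quantities only inside the classes. So
  `n - k ≤ M`.
* Upper bounds. Given a balanced labelling, each class is treated separately. A class of `r` places
  can be supplied along at most `r - 1` pairs by the northwest corner rule
  (`PCFCT.exists_isPlan`), and its coordinates can be moved from `a` to `b` in at most `r - 1` edges
  of the polytope (`BoxInstance.exists_walk_finishing`): each edge changes two coordinates and brings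
  one of them to its final value, and at most one coordinate is off its bounds at any time. Adding up
  gives `n` minus the number of classes.

If all supplies and demands are positive, every class meets both `S` and `T`, so that balanced
labellings with `m` classes are the same thing as same-sum partitions of size `m`.
-/

open Finset

/-! ### Balanced labellings -/

/-- Merging labels along a list of pairs: some labelling is constant on every pair, and each pair
costs at most one label. -/
theorem exists_labelling_of_pairs {V : Type*} [Fintype V] (E : List (V × V)) :
    ∃ f : V → ℕ, (∀ e ∈ E, f e.1 = f e.2) ∧
      Fintype.card V ≤ (univ.image f).card + E.length := by
  induction E with
  | nil =>
    refine ⟨Fin.val ∘ Fintype.equivFin V, by simp, ?_⟩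
    rw [card_image_of_injective _ (Fin.val_injective.comp (Fintype.equivFin V).injective)]
    simp
  | cons e E ih =>
    obtain ⟨f, hf, hc⟩ := ih
    refine ⟨fun v => if f v = f e.1 then f e.2 else f v, ?_, ?_⟩
    · intro e' he'
      rcases List.mem_cons.1 he' with rfl | h
      · simp
      · simp only [hf e' h]
    · have hsub : (univ.image f).erase (f e.1) ⊆
          univ.image (fun v => if f v = f e.1 then f e.2 else f v) := by
        intro k hk
        obtain ⟨hne, hk⟩ := mem_erase.1 hk
        obtain ⟨v, -, rfl⟩ := mem_image.1 hk
        exact mem_image.2 ⟨v, mem_univ _, if_neg hne⟩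
      have h1 := card_le_card hsub
      have h2 := pred_card_le_card_erase (s := univ.image f) (a := f e.1)
      simp only [List.length_cons]
      omega

namespace BoxInstance

variable {ι : Type*} [Fintype ι] (Q : BoxInstance ι)

/-- A labelling of the coordinates is balanced when `a` and `b` have the same sum over each class,
a class being the set of coordinates with a given label. -/
def IsBalanced (f : ι → ℕ) : Prop :=
  ∀ k, ∑ i with f i = k, Q.a i = ∑ i with f i = k, Q.b i

/-- The largest number of classes of a balanced labelling is attained. The constant labelling is
balanced, so balanced labellings exist. -/
theorem exists_isGreatest_card_image :
    ∃ M, IsGreatest {c | ∃ f, Q.IsBalanced f ∧ (univ.image f).card = c} M := by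
  have hne : {c | ∃ f, Q.IsBalanced f ∧ (univ.image f).card = c}.Nonempty := by
    refine ⟨_, fun _ => 0, fun k => ?_, rfl⟩
    by_cases hk : 0 = k
    · simpa [hk] using Q.sum_eq
    · simp [hk]
  have hbdd : BddAbove {c | ∃ f, Q.IsBalanced f ∧ (univ.image f).card = c} := by
    refine ⟨Fintype.card ι, ?_⟩
    rintro c ⟨f, -, rfl⟩
    exact card_image_le
  exact ⟨_, Nat.sSup_mem hne hbdd, fun c hc => le_csSup hbdd hc⟩

/-! ### Edges of the polytope -/

/-- Coordinate `k` of `x` is at one of its bounds. -/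
def AtBound (x : ι → ℝ) (k : ι) : Prop :=
  x k = (Q.lower k : ℝ) ∨ x k = (Q.upper k : ℝ)

theorem convex_polytope : Convex ℝ Q.polytope := by
  intro x hx y hy p q hp hq hpq
  refine ⟨fun i => ⟨?_, ?_⟩, ?_⟩
  · have h1 := mul_le_mul_of_nonneg_left (hx.1 i).1 hp
    have h2 := mul_le_mul_of_nonneg_left (hy.1 i).1 hq
    simp only [Pi.add_apply, Pi.smul_apply, smul_eq_mul]
    linear_combination h1 + h2 - (Q.lower i : ℝ) * hpq
  · have h1 := mul_le_mul_of_nonneg_left (hx.1 i).2 hp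
    have h2 := mul_le_mul_of_nonneg_left (hy.1 i).2 hq
    simp only [Pi.add_apply, Pi.smul_apply, smul_eq_mul]
    linear_combination h1 + h2 + (Q.upper i : ℝ) * hpq
  · simp only [Pi.add_apply, Pi.smul_apply, smul_eq_mul, sum_add_distrib, ← mul_sum, hx.2, hy.2]
    linear_combination (Q.total : ℝ) * hpq

/-- Adjacent vertices differ in at most two coordinates. Otherwise the midpoint of the edge could be
moved inside the polytope, in a direction other than that of the edge, both forwards and backwards;
the functional exposing the edge would be maximal at the resulting points too. -/
theorem exists_pair_of_adj {x y : Q.Vertex} (h : Q.skeleton.Adj x y) :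
    ∃ i j, ∀ k, k ≠ i → k ≠ j → x.1 k = y.1 k := by
  classical
  obtain ⟨hne, hexp⟩ := h
  obtain ⟨ℓ, hℓ⟩ := hexp ⟨x.1, left_mem_segment ℝ _ _⟩
  have hxP : x.1 ∈ Q.polytope := x.2.1
  have hyP : y.1 ∈ Q.polytope := y.2.1
  obtain ⟨i, hi⟩ : ∃ i, x.1 i ≠ y.1 i := by
    by_contra! hc
    exact hne (Subtype.ext (funext hc))
  obtain ⟨j, hji, hj⟩ : ∃ j, j ≠ i ∧ x.1 j ≠ y.1 j := by
    by_contra! hc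
    have h0 : ∑ k, (x.1 k - y.1 k) = x.1 i - y.1 i :=
      sum_eq_single i (fun k _ hk => sub_eq_zero.2 (hc k hk)) (by simp)
    rw [sum_sub_distrib, hxP.2, hyP.2, sub_self] at h0
    exact hi (sub_eq_zero.1 h0.symm)
  refine ⟨i, j, fun k hki hkj => ?_⟩
  by_contra hk
  -- The midpoint is strictly between the bounds in every coordinate where `x` and `y` differ.
  have hstrict : ∀ k, x.1 k ≠ y.1 k →
      (Q.lower k : ℝ) < (x.1 k + y.1 k) / 2 ∧ (x.1 k + y.1 k) / 2 < Q.upper k := by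
    intro k hk
    have h1 := hxP.1 k
    have h2 := hyP.1 k
    rcases lt_or_gt_of_ne hk with h | h <;> constructor <;> linarith
  have hsi := hstrict i hi
  have hsj := hstrict j hj
  obtain ⟨ε, hε, h1, h2, h3, h4⟩ : ∃ ε : ℝ, 0 < ε ∧
      ε ≤ (x.1 i + y.1 i) / 2 - Q.lower i ∧ ε ≤ Q.upper i - (x.1 i + y.1 i) / 2 ∧
      ε ≤ (x.1 j + y.1 j) / 2 - Q.lower j ∧ ε ≤ Q.upper j - (x.1 j + y.1 j) / 2 :=
    ⟨min (min _ _) (min _ _),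
      lt_min (lt_min (sub_pos.2 hsi.1) (sub_pos.2 hsi.2))
        (lt_min (sub_pos.2 hsj.1) (sub_pos.2 hsj.2)),
      (min_le_left _ _).trans (min_le_left _ _), (min_le_left _ _).trans (min_le_right _ _),
      (min_le_right _ _).trans (min_le_left _ _), (min_le_right _ _).trans (min_le_right _ _)⟩
  set p : ℝ → ι → ℝ := fun σ l =>
    (x.1 l + y.1 l) / 2 + ((if l = i then σ else 0) - if l = j then σ else 0) with hp
  have hpP : ∀ σ, -ε ≤ σ → σ ≤ ε → p σ ∈ Q.polytope := by
    refine fun σ hσ hσ' => ⟨fun l => ?_, ?_⟩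
    · have hx := hxP.1 l
      have hy := hyP.1 l
      by_cases hli : l = i
      · subst hli
        simp only [hp, if_true, if_neg hji.symm]
        constructor <;> linarith
      by_cases hlj : l = j
      · subst hlj
        simp only [hp, if_true, if_neg hli]
        constructor <;> linarith
      · simp only [hp, if_neg hli, if_neg hlj]
        constructor <;> linarith
    · simp only [hp, sum_add_distrib, sum_sub_distrib, ← sum_div, hxP.2, hyP.2, sum_ite_eq',
        mem_univ, if_true]
      ring
  have hx : x.1 ∈ segment ℝ x.1 y.1 := left_mem_segment ℝ _ _
  have hy : y.1 ∈ segment ℝ x.1 y.1 := right_mem_segment ℝ _ _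
  rw [hℓ] at hx hy
  have hm1 := hx.2 _ (hpP ε (by linarith) le_rfl)
  have hm2 := hx.2 _ (hpP (-ε) le_rfl (by linarith))
  have hadd : p ε + p (-ε) = x.1 + y.1 := by
    ext l
    simp only [hp, Pi.add_apply]
    split_ifs <;> ring
  have hsum : ℓ (p ε) + ℓ (p (-ε)) = ℓ x.1 + ℓ y.1 := by rw [← map_add, hadd, map_add]
  have hmem : p ε ∈ segment ℝ x.1 y.1 := by
    rw [hℓ]
    refine ⟨hpP ε (by linarith) le_rfl, fun w hw => (hx.2 w hw).trans ?_⟩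
    have := hy.2 _ hx.1
    linarith
  obtain ⟨q, r, -, -, hqr, he⟩ := hmem
  have hek := congrFun he k
  have hei := congrFun he i
  simp only [hp, Pi.add_apply, Pi.smul_apply, smul_eq_mul, if_neg hki, if_neg hkj, if_true,
    if_neg hji.symm] at hek hei
  -- Coordinate `k` forces the point to be the midpoint, coordinate `i` says that it is not.
  have hq : (q - 1 / 2) * (x.1 k - y.1 k) = 0 := by linear_combination hek - y.1 k * hqr
  have hq' := (mul_eq_zero.1 hq).resolve_right (sub_ne_zero.2 hk)
  have : ε = 0 := by linear_combination -hei + (x.1 i - y.1 i) * hq' + y.1 i * hqr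
  exact hε.ne' this

/-- Two distinct vertices that differ only in the coordinates `i` and `j` are adjacent if all other
coordinates are at a bound: fixing these coordinates cuts out a face contained in a line, and the
two vertices, being extreme points, are the ends of this face. -/
theorem adj_of_pair {x y : Q.Vertex} (hne : x ≠ y) {i j : ι} (hij : i ≠ j)
    (heq : ∀ k, k ≠ i → k ≠ j → x.1 k = y.1 k)
    (hc : ∀ k, k ≠ i → k ≠ j → Q.AtBound x.1 k) :
    Q.skeleton.Adj x y := by
  classical
  refine ⟨hne, fun _ => ?_⟩
  have hxP : x.1 ∈ Q.polytope := x.2.1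
  have hyP : y.1 ∈ Q.polytope := y.2.1
  let c : ι → ℝ := fun k => if k = i ∨ k = j then 0 else if x.1 k = Q.upper k then 1 else -1
  let ℓ : StrongDual ℝ (ι → ℝ) := ∑ k, c k • ContinuousLinearMap.proj k
  have hℓ : ∀ w, ℓ w = ∑ k, c k * w k := fun w => by simp [ℓ]
  have hle : ∀ w ∈ Q.polytope, ∀ k, c k * w k ≤ c k * x.1 k := by
    intro w hw k
    have hwk := hw.1 k
    by_cases hk : k = i ∨ k = j
    · simp [c, hk]
    · by_cases hu : x.1 k = Q.upper k
      · simp only [c, if_neg hk, if_pos hu]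
        linarith
      · have hl := (hc k (fun h => hk (.inl h)) (fun h => hk (.inr h))).resolve_right hu
        simp only [c, if_neg hk, if_neg hu]
        linarith
  have hface : ∀ w, (∀ k, k ≠ i → k ≠ j → w k = x.1 k) → ℓ w = ℓ x.1 := by
    intro w hw
    rw [hℓ, hℓ]
    refine sum_congr rfl fun k _ => ?_
    by_cases hk : k = i ∨ k = j
    · simp [c, hk]
    · rw [hw k (fun h => hk (.inl h)) (fun h => hk (.inr h))]
  refine ⟨ℓ, Set.Subset.antisymm ?_ ?_⟩
  · intro w hw
    refine ⟨Q.convex_polytope.segment_subset hxP hyP hw, fun v hv => ?_⟩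
    obtain ⟨q, r, -, -, hqr, rfl⟩ := hw
    rw [hface (q • x.1 + r • y.1) fun k hki hkj => ?_, hℓ, hℓ]
    · exact sum_le_sum fun k _ => hle v hv k
    · change q * x.1 k + r * y.1 k = x.1 k
      rw [← heq k hki hkj, ← add_mul, hqr, one_mul]
  · rintro w ⟨hwP, hmax⟩
    have hw : ∀ k, k ≠ i → k ≠ j → w k = x.1 k := by
      intro k hki hkj
      have h1 := hmax _ hxP
      rw [hℓ, hℓ] at h1
      have h2 := (sum_eq_sum_iff_of_le fun k _ => hle w hwP k).1
        (le_antisymm (sum_le_sum fun k _ => hle w hwP k) h1) k (mem_univ k)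
      have h3 : c k ≠ 0 := by
        simp only [c, hki, hkj, or_self, if_false]
        split_ifs <;> norm_num
      exact mul_left_cancel₀ h3 h2
    -- On the face, the sum of the coordinates `i` and `j` is constant.
    have hpair : ∀ w ∈ Q.polytope, (∀ k, k ≠ i → k ≠ j → w k = x.1 k) →
        w j - x.1 j = -(w i - x.1 i) := by
      intro w hwP hw
      have h0 : ∑ k, (w k - x.1 k) = 0 := by rw [sum_sub_distrib, hwP.2, hxP.2, sub_self]
      rw [sum_eq_add i j hij (fun k _ hk => sub_eq_zero.2 (hw k hk.1 hk.2)) (by simp)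
        (by simp)] at h0
      linarith
    have hwj := hpair w hwP hw
    have hyj := hpair y.1 hyP fun k h1 h2 => (heq k h1 h2).symm
    have hyi : y.1 i - x.1 i ≠ 0 := by
      intro h
      refine hne (Subtype.ext (funext fun k => ?_))
      by_cases hki : k = i
      · subst hki; linarith
      by_cases hkj : k = j
      · subst hkj; linarith
      exact heq k hki hkj
    obtain ⟨θ, hθ⟩ : ∃ θ, θ * (y.1 i - x.1 i) = w i - x.1 i := ⟨_, div_mul_cancel₀ _ hyi⟩
    have hline : ∀ k, w k = x.1 k + θ * (y.1 k - x.1 k) := by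
      intro k
      by_cases hki : k = i
      · subst hki; linarith
      by_cases hkj : k = j
      · subst hkj; rw [hyj]; linarith
      rw [hw k hki hkj, heq k hki hkj]; ring
    have hsegment : 0 ≤ θ → θ ≤ 1 → w ∈ segment ℝ x.1 y.1 := fun h0 h1 =>
      ⟨1 - θ, θ, by linarith, h0, by ring, funext fun k => by
        simp only [Pi.add_apply, Pi.smul_apply, smul_eq_mul, hline k]; ring⟩
    rcases lt_or_ge θ 0 with h0 | h0
    · -- Beyond `x`: impossible, unless `w = x`, since `x` is extreme.
      have hd : 0 < 1 - θ := by linarith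
      have := (mem_extremePoints.1 x.2).2 w hwP y.1 hyP
        ⟨1 / (1 - θ), -θ / (1 - θ), by positivity, div_pos (by linarith) hd,
          by field_simp; ring, funext fun k => by
            simp only [Pi.add_apply, Pi.smul_apply, smul_eq_mul, hline k]
            field_simp
            ring⟩
      rw [this.1]
      exact left_mem_segment ℝ _ _
    rcases le_or_gt θ 1 with h1 | h1
    · exact hsegment h0 h1
    · have hd : 0 < θ := by linarith
      have := (mem_extremePoints.1 y.2).2 x.1 hxP w hwP
        ⟨(θ - 1) / θ, 1 / θ, div_pos (by linarith) hd, by positivity,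
          by field_simp; ring, funext fun k => by
            simp only [Pi.add_apply, Pi.smul_apply, smul_eq_mul, hline k]
            field_simp
            ring⟩
      rw [this.2]
      exact right_mem_segment ℝ _ _

/-! ### Walks on the skeleton -/

/-- A walk changes one pair of coordinates per step, so the sums over the classes of a labelling
that is constant on all these pairs do not change along the walk. -/
theorem exists_pairs_of_walk {x y : Q.Vertex} (p : Q.skeleton.Walk x y) :
    ∃ E : List (ι × ι), E.length = p.length ∧ ∀ f : ι → ℕ, (∀ e ∈ E, f e.1 = f e.2) →
      ∀ k, ∑ i with f i = k, x.1 i = ∑ i with f i = k, y.1 i := by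
  classical
  induction p with
  | nil => exact ⟨[], rfl, fun _ _ _ => rfl⟩
  | @cons x z y h p ih =>
    obtain ⟨E, hE, hf⟩ := ih
    obtain ⟨i, j, hij⟩ := Q.exists_pair_of_adj h
    refine ⟨(i, j) :: E, by simp [hE], fun f hfE k => ?_⟩
    rw [← hf f (fun e he => hfE e (List.mem_cons_of_mem _ he)) k]
    have hfij : f i = f j := hfE (i, j) List.mem_cons_self
    by_cases hk : f i = k
    · -- All changes happen inside the class, and the total sum is constant.
      have hxP : x.1 ∈ Q.polytope := x.2.1
      have hzP : z.1 ∈ Q.polytope := z.2.1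
      have h1 := sum_filter_add_sum_filter_not univ (fun l => f l = k) x.1
      have h2 := sum_filter_add_sum_filter_not univ (fun l => f l = k) z.1
      have h3 : ∑ l with ¬f l = k, x.1 l = ∑ l with ¬f l = k, z.1 l := by
        refine sum_congr rfl fun l hl => hij l ?_ ?_ <;> rintro rfl
        · exact (mem_filter.1 hl).2 hk
        · exact (mem_filter.1 hl).2 (hfij ▸ hk)
      rw [hxP.2] at h1
      rw [hzP.2] at h2
      linarith
    · refine sum_congr rfl fun l hl => hij l ?_ ?_ <;> rintro rfl
      · exact hk (mem_filter.1 hl).2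
      · exact hk (hfij.trans (mem_filter.1 hl).2)

theorem exists_isBalanced_of_walk (p : Q.skeleton.Walk Q.source Q.target) :
    ∃ f, Q.IsBalanced f ∧ Fintype.card ι ≤ (univ.image f).card + p.length := by
  obtain ⟨E, hE, hf⟩ := Q.exists_pairs_of_walk p
  obtain ⟨f, hfE, hc⟩ := exists_labelling_of_pairs E
  refine ⟨f, fun k => ?_, hE ▸ hc⟩
  have := hf f hfE k
  simp only [source, target] at this
  exact_mod_cast this

variable {Q}

theorem atBound_of_eq_a {x : ι → ℝ} {k : ι} (h : x k = Q.a k) : Q.AtBound x k := by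
  rcases le_total (Q.a k) (Q.b k) with h' | h'
  · left; simp [h, lower, h']
  · right; simp [h, upper, h']

theorem atBound_of_eq_b {x : ι → ℝ} {k : ι} (h : x k = Q.b k) : Q.AtBound x k := by
  rcases le_total (Q.a k) (Q.b k) with h' | h'
  · right; simp [h, upper, h']
  · left; simp [h, lower, h']

theorem lower_le_b (k : ι) : (Q.lower k : ℝ) ≤ Q.b k := Nat.cast_le.2 (min_le_right _ _)

theorem b_le_upper (k : ι) : (Q.b k : ℝ) ≤ Q.upper k := Nat.cast_le.2 (le_max_right _ _)

/-- A point of the polytope is a vertex if at most one coordinate is not at a bound. -/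
theorem mem_extremePoints_of_atBound {x : ι → ℝ} (hx : x ∈ Q.polytope) (o : ι)
    (hc : ∀ k, k ≠ o → Q.AtBound x k) : x ∈ Set.extremePoints ℝ Q.polytope := by
  classical
  rw [mem_extremePoints_iff_left]
  refine ⟨hx, ?_⟩
  rintro y hy z hz ⟨p, q, hp, hq, hpq, h⟩
  have hne : ∀ k, k ≠ o → y k = x k := by
    intro k hk
    have hi : p * y k + q * z k = x k := by simpa using congrFun h k
    have h1 := hy.1 k
    have h2 := hz.1 k
    refine sub_eq_zero.1 ((mul_eq_zero.1 ?_ : p = 0 ∨ y k - x k = 0).resolve_left hp.ne')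
    rcases hc k hk with c | c
    · have py := mul_nonneg hp.le (by linarith : 0 ≤ y k - x k)
      have qz := mul_nonneg hq.le (by linarith : 0 ≤ z k - x k)
      refine le_antisymm ?_ ?_ <;> linarith [congrArg (· * x k) hpq]
    · have py := mul_nonneg hp.le (by linarith : 0 ≤ x k - y k)
      have qz := mul_nonneg hq.le (by linarith : 0 ≤ x k - z k)
      refine le_antisymm ?_ ?_ <;> linarith [congrArg (· * x k) hpq]
  have h0 : ∑ k, (y k - x k) = 0 := by rw [sum_sub_distrib, hy.2, hx.2, sub_self]
  rw [sum_eq_single o (fun k _ hk => sub_eq_zero.2 (hne k hk)) (by simp)] at h0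
  funext k
  by_cases hk : k = o
  · subst hk; exact sub_eq_zero.1 h0
  · exact hne k hk

/-- If the coordinates `e` and `o` deviate from `b` with opposite signs, `e` by no more than `o`,
and all others are at a bound, then one edge leads to a vertex where `e` has reached its final
value at the expense of `o`. -/
theorem exists_adj_finishing {x : Q.Vertex} {e o : ι} (heo : e ≠ o) (he : x.1 e ≠ Q.b e)
    (hsign : (x.1 e - Q.b e) * (x.1 o - Q.b o) < 0)
    (habs : |x.1 e - Q.b e| ≤ |x.1 o - Q.b o|)
    (hc : ∀ k, k ≠ e → k ≠ o → Q.AtBound x.1 k) :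
    ∃ z : Q.Vertex, Q.skeleton.Adj x z ∧ z.1 e = Q.b e ∧ z.1 o = x.1 o + (x.1 e - Q.b e) ∧
      ∀ k, k ≠ e → k ≠ o → z.1 k = x.1 k := by
  classical
  have hxP : x.1 ∈ Q.polytope := x.2.1
  set z : ι → ℝ := fun k =>
    if k = e then (Q.b e : ℝ) else if k = o then x.1 o + (x.1 e - Q.b e) else x.1 k with hz
  have hze : z e = Q.b e := if_pos rfl
  have hzo : z o = x.1 o + (x.1 e - Q.b e) := by simp [hz, heo.symm]
  have hzk : ∀ k, k ≠ e → k ≠ o → z k = x.1 k := fun k h1 h2 => by simp [hz, h1, h2]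
  have hzP : z ∈ Q.polytope := by
    refine ⟨fun k => ?_, ?_⟩
    · have hxk := hxP.1 k
      by_cases h1 : k = e
      · subst h1
        rw [hze]
        exact ⟨lower_le_b _, b_le_upper _⟩
      by_cases h2 : k = o
      · subst h2
        rw [hzo]
        have hl := lower_le_b (Q := Q) k
        have hu := b_le_upper (Q := Q) k
        rcases mul_neg_iff.1 hsign with ⟨h3, h4⟩ | ⟨h3, h4⟩
        · rw [abs_of_pos h3, abs_of_neg h4] at habs
          constructor <;> linarith
        · rw [abs_of_neg h3, abs_of_pos h4] at habs
          constructor <;> linarith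
      · rw [hzk k h1 h2]
        exact hxk
    · have h0 : ∑ k, (z k - x.1 k) = 0 := by
        rw [sum_eq_add e o heo (fun k _ hk => sub_eq_zero.2 (hzk k hk.1 hk.2)) (by simp)
          (by simp), hze, hzo]
        ring
      rw [sum_sub_distrib, hxP.2] at h0
      linarith
  have hzV : z ∈ Set.extremePoints ℝ Q.polytope := by
    refine mem_extremePoints_of_atBound hzP o fun k hk => ?_
    by_cases h1 : k = e
    · subst h1
      exact atBound_of_eq_b hze
    · simpa only [AtBound, hzk k h1 hk] using hc k h1 hk
  refine ⟨⟨z, hzV⟩, Q.adj_of_pair ?_ heo (fun k h1 h2 => (hzk k h1 h2).symm) hc, hze, hzo, hzk⟩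
  intro h
  exact he ((congrFun (congrArg Subtype.val h) e).trans hze)

/-- A class `K` on which the current vertex and `b` have the same sum can be brought to its final
values in `#K - 1` steps: each step finishes one coordinate, and the last coordinate is then
finished too. At most one coordinate of the class is off its bounds at any time; it takes part in
the next step. -/
theorem exists_walk_finishing (n : ℕ) : ∀ (K : Finset ι), K.card = n + 1 → ∀ x : Q.Vertex,
    (∃ o, ∀ k, k ≠ o → Q.AtBound x.1 k) → (∀ k, k ∉ K → Q.AtBound x.1 k) →
    ∑ k ∈ K, x.1 k = ∑ k ∈ K, (Q.b k : ℝ) →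
    ∃ y : Q.Vertex, (∀ k ∈ K, y.1 k = Q.b k) ∧ (∀ k, k ∉ K → y.1 k = x.1 k) ∧
      ∃ p : Q.skeleton.Walk x y, p.length ≤ n := by
  classical
  induction n with
  | zero =>
    intro K hK x _ _ hsum
    obtain ⟨v, rfl⟩ := card_eq_one.1 hK
    exact ⟨x, by simpa using hsum, fun _ _ => rfl, .nil, le_rfl⟩
  | succ n ih =>
    intro K hK x ho hout hsum
    by_cases hfin : ∃ v ∈ K, x.1 v = Q.b v
    · obtain ⟨v, hv, hxv⟩ := hfin
      obtain ⟨y, hy, hy', p, hp⟩ := ih (K.erase v) (by rw [card_erase_of_mem hv, hK]; rfl) x ho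
        (fun k hk => by
          by_cases hkv : k = v
          · subst hkv; exact atBound_of_eq_b hxv
          · exact hout k fun h => hk (mem_erase.2 ⟨hkv, h⟩))
        (by
          rw [← add_sum_erase K _ hv, ← add_sum_erase K _ hv, hxv] at hsum
          exact add_left_cancel hsum)
      refine ⟨y, fun k hk => ?_, fun k hk => hy' k fun h => hk (mem_of_mem_erase h), p, by omega⟩
      by_cases hkv : k = v
      · subst hkv
        rw [hy' k (by simp), hxv]
      · exact hy k (mem_erase.2 ⟨hkv, hk⟩)
    · push Not at hfin
      obtain ⟨v, hv, hvb⟩ : ∃ v ∈ K, ∀ k, k ≠ v → Q.AtBound x.1 k := by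
        obtain ⟨o, ho⟩ := ho
        by_cases hoK : o ∈ K
        · exact ⟨o, hoK, ho⟩
        · obtain ⟨v, hv⟩ : K.Nonempty := card_pos.1 (by omega)
          exact ⟨v, hv, fun k _ => if hk : k = o then hout k (hk ▸ hoK) else ho k hk⟩
      obtain ⟨w, hw, hsign⟩ : ∃ w ∈ K, (x.1 v - Q.b v) * (x.1 w - Q.b w) < 0 := by
        by_contra! hc
        have h0 : ∑ k ∈ K, (x.1 v - Q.b v) * (x.1 k - Q.b k) = 0 := by
          rw [← mul_sum, sum_sub_distrib, hsum, sub_self, mul_zero]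
        have := (sum_eq_zero_iff_of_nonneg hc).1 h0 v hv
        exact hfin v hv (sub_eq_zero.1 (mul_self_eq_zero.1 this))
      have hvw : v ≠ w := by
        rintro rfl
        exact absurd hsign (not_lt.2 (mul_self_nonneg _))
      -- Of the two coordinates, `e` is the one that the step finishes.
      obtain ⟨e, o, he, ho, heo, hsign, habs, hc⟩ : ∃ e o, e ∈ K ∧ o ∈ K ∧ e ≠ o ∧
          (x.1 e - Q.b e) * (x.1 o - Q.b o) < 0 ∧ |x.1 e - Q.b e| ≤ |x.1 o - Q.b o| ∧
          ∀ k, k ≠ e → k ≠ o → Q.AtBound x.1 k := by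
        rcases le_total |x.1 v - Q.b v| |x.1 w - Q.b w| with h | h
        · exact ⟨v, w, hv, hw, hvw, hsign, h, fun k hk _ => hvb k hk⟩
        · exact ⟨w, v, hw, hv, hvw.symm, by rwa [mul_comm], h, fun k _ hk => hvb k hk⟩
      obtain ⟨z, hadj, hze, hzo, hzk⟩ := exists_adj_finishing heo (hfin e he) hsign habs hc
      have hzb : ∀ k, k ≠ e → k ≠ o → Q.AtBound z.1 k := fun k h1 h2 => by
        simpa only [AtBound, hzk k h1 h2] using hc k h1 h2
      have hze' : Q.AtBound z.1 e := atBound_of_eq_b hze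
      have hzsum : ∑ k ∈ K, z.1 k = ∑ k ∈ K, (Q.b k : ℝ) := by
        have h0 : ∑ k ∈ K, (z.1 k - x.1 k) = 0 := by
          rw [sum_eq_add e o heo (fun k _ hk => sub_eq_zero.2 (hzk k hk.1 hk.2))
            (fun h => absurd he h) (fun h => absurd ho h), hze, hzo]
          ring
        rw [sum_sub_distrib] at h0
        linarith
      obtain ⟨y, hy, hy', p, hp⟩ := ih (K.erase e) (by rw [card_erase_of_mem he, hK]; rfl) z
        ⟨o, fun k hk => if h : k = e then h ▸ hze' else hzb k h hk⟩
        (fun k hk => by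
          by_cases hke : k = e
          · exact hke ▸ hze'
          · exact hzb k hke fun h => hk (mem_erase.2 ⟨hke, h ▸ ho⟩))
        (by
          rw [← add_sum_erase K _ he, ← add_sum_erase K _ he, hze] at hzsum
          exact add_left_cancel hzsum)
      refine ⟨y, fun k hk => ?_, fun k hk => ?_, .cons hadj p, by simpa using hp⟩
      · by_cases hke : k = e
        · subst hke
          rw [hy' k (by simp), hze]
        · exact hy k (mem_erase.2 ⟨hke, hk⟩)
      · rw [hy' k fun h => hk (mem_of_mem_erase h)]
        exact hzk k (fun h => hk (h ▸ he)) (fun h => hk (h ▸ ho))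

/-- Finishing the classes of a balanced labelling one after the other gives a walk from `a` to `b`
that has one step less than coordinates for each class. -/
theorem IsBalanced.exists_walk {f : ι → ℕ} (hf : Q.IsBalanced f) :
    ∃ p : Q.skeleton.Walk Q.source Q.target,
      p.length + (univ.image f).card ≤ Fintype.card ι := by
  classical
  have key : ∀ C ⊆ univ.image f, ∃ y : Q.Vertex, (∀ k, f k ∈ C → y.1 k = Q.b k) ∧
      (∀ k, f k ∉ C → y.1 k = Q.a k) ∧ ∃ p : Q.skeleton.Walk Q.source y,
        p.length + C.card ≤ ∑ c ∈ C, (univ.filter fun k => f k = c).card := by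
    intro C
    induction C using Finset.induction_on with
    | empty => exact fun _ => ⟨Q.source, by simp, fun _ _ => rfl, .nil, by simp⟩
    | insert c C hc ih =>
      intro hC
      obtain ⟨x, hx, hx', p, hp⟩ := ih ((subset_insert _ _).trans hC)
      have hb : ∀ k, Q.AtBound x.1 k := fun k =>
        if h : f k ∈ C then atBound_of_eq_b (hx k h) else atBound_of_eq_a (hx' k h)
      obtain ⟨v, -, hv⟩ := mem_image.1 (hC (mem_insert_self c C))
      have hpos : 0 < (univ.filter fun k => f k = c).card :=
        card_pos.2 ⟨v, mem_filter.2 ⟨mem_univ v, hv⟩⟩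
      obtain ⟨y, hy, hy', q, hq⟩ := exists_walk_finishing
        ((univ.filter fun k => f k = c).card - 1) (univ.filter fun k => f k = c) (by omega) x
        ⟨v, fun k _ => hb k⟩ (fun k _ => hb k)
        (by
          have hxa : ∀ k ∈ univ.filter fun k => f k = c, x.1 k = Q.a k := fun k hk =>
            hx' k ((mem_filter.1 hk).2 ▸ hc)
          rw [sum_congr rfl hxa]
          exact_mod_cast hf c)
      refine ⟨y, fun k hk => ?_, fun k hk => ?_, p.append q, ?_⟩
      · by_cases hkc : f k = c
        · exact hy k (by simp [hkc])
        · rw [hy' k (by simp [hkc])]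
          exact hx k ((mem_insert.1 hk).resolve_left hkc)
      · rw [mem_insert, not_or] at hk
        rw [hy' k (by simp [hk.1])]
        exact hx' k hk.2
      · rw [SimpleGraph.Walk.length_append, card_insert_of_notMem hc, sum_insert hc]
        omega
  obtain ⟨y, hy, -, p, hp⟩ := key _ Subset.rfl
  obtain rfl : y = Q.target :=
    Subtype.ext (funext fun k => hy k (mem_image_of_mem f (mem_univ k)))
  refine ⟨p, hp.trans_eq ?_⟩
  rw [← card_univ, card_eq_sum_card_image f univ]

end BoxInstance

namespace PCFCT

variable {S T : Type*} [Fintype S] [Fintype T]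

/-! ### The northwest corner rule -/

/-- The plan `x` ships, along pairs in `A × B` only, the supplies `s` of `A` to the demands `t` of
`B`. -/
structure IsPlan (A : Finset S) (B : Finset T) (s : S → ℝ) (t : T → ℝ) (x : S → T → ℝ) :
    Prop where
  nonneg : ∀ i j, 0 ≤ x i j
  mem : ∀ i j, x i j ≠ 0 → i ∈ A ∧ j ∈ B
  supply : ∀ i ∈ A, ∑ j, x i j = s i
  demand : ∀ j ∈ B, ∑ i, x i j = t j

theorem IsPlan.swap {A : Finset S} {B : Finset T} {s : S → ℝ} {t : T → ℝ} {x : S → T → ℝ}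
    (h : IsPlan A B s t x) : IsPlan B A t s fun j i => x i j :=
  ⟨fun j i => h.nonneg i j, fun j i hx => (h.mem i j hx).symm, h.demand, h.supply⟩

theorem value_swap {S T : Type*} (x : S → T → ℝ) : value (fun j i => x i j) = value x := by
  unfold value
  rw [← Set.ncard_image_of_injective _ Prod.swap_injective, Set.image_swap_eq_preimage_swap]
  rfl

/-- Shipping the whole supply of `i` to `j` adds one pair to a plan for the rest. -/
theorem exists_isPlan_of_erase [DecidableEq S] [DecidableEq T] {A : Finset S} {B : Finset T}
    {s : S → ℝ} {t : T → ℝ} {i : S} {j : T} (hi : i ∈ A) (hj : j ∈ B) (hs : 0 ≤ s i)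
    {x : S → T → ℝ} (hx : IsPlan (A.erase i) B s (Function.update t j (t j - s i)) x) :
    ∃ y, IsPlan A B s t y ∧ value y ≤ value x + 1 := by
  have hxi : ∀ j', x i j' = 0 := fun j' => by
    by_contra h
    simpa using (hx.mem i j' h).1
  refine ⟨fun i' j' => x i' j' + if i' = i ∧ j' = j then s i else 0, ⟨?_, ?_, ?_, ?_⟩, ?_⟩
  · intro i' j'
    have := hx.nonneg i' j'
    split_ifs <;> linarith
  · intro i' j' h
    by_cases h' : i' = i ∧ j' = j
    · exact ⟨h'.1 ▸ hi, h'.2 ▸ hj⟩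
    · have := hx.mem i' j' (by simpa [h'] using h)
      exact ⟨mem_of_mem_erase this.1, this.2⟩
  · intro i' hi'
    by_cases h : i' = i
    · subst h
      simp [hxi]
    · simpa [h] using hx.supply i' (mem_erase.2 ⟨h, hi'⟩)
  · intro j' hj'
    have := hx.demand j' hj'
    by_cases h : j' = j
    · subst h
      simp [sum_add_distrib, this]
    · simpa [h] using this
  · unfold value
    refine (Set.ncard_le_ncard (t := insert (i, j) {p | 0 < x p.1 p.2}) ?_).trans
      (Set.ncard_insert_le _ _)
    rintro ⟨i', j'⟩ h
    by_cases h' : i' = i ∧ j' = j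
    · left; rw [h'.1, h'.2]
    · right; simpa [h'] using h

theorem isPlan_zero {A : Finset S} {B : Finset T} {s : S → ℝ} {t : T → ℝ}
    (hs : ∀ i ∈ A, s i = 0) (ht : ∀ j ∈ B, t j = 0) : IsPlan A B s t fun _ _ => 0 :=
  ⟨fun _ _ => le_rfl, fun _ _ h => absurd rfl h, fun i hi => by simp [hs i hi],
    fun j hj => by simp [ht j hj]⟩

/-- The northwest corner rule: a plan with fewer pairs than there are places. -/
theorem exists_isPlan (n : ℕ) : ∀ (A : Finset S) (B : Finset T) (s : S → ℝ) (t : T → ℝ),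
    A.card + B.card = n + 1 → (∀ i ∈ A, 0 ≤ s i) → (∀ j ∈ B, 0 ≤ t j) →
    ∑ i ∈ A, s i = ∑ j ∈ B, t j → ∃ x, IsPlan A B s t x ∧ value x ≤ n := by
  classical
  have hzero : value (fun (_ : S) (_ : T) => (0 : ℝ)) = 0 := by simp [value]
  induction n with
  | zero =>
    intro A B s t hc hs ht hsum
    refine ⟨fun _ _ => 0, ?_, hzero.le⟩
    rcases (by omega : A.card = 0 ∨ B.card = 0) with h | h <;> rw [card_eq_zero] at h <;> subst h
    · exact isPlan_zero (by simp) ((sum_eq_zero_iff_of_nonneg ht).1 (by simpa using hsum.symm))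
    · exact isPlan_zero ((sum_eq_zero_iff_of_nonneg hs).1 (by simpa using hsum)) (by simp)
  | succ n ih =>
    intro A B s t hc hs ht hsum
    rcases A.eq_empty_or_nonempty with rfl | ⟨i, hi⟩
    · exact ⟨fun _ _ => 0, isPlan_zero (by simp)
        ((sum_eq_zero_iff_of_nonneg ht).1 (by simpa using hsum.symm)), by omega⟩
    rcases B.eq_empty_or_nonempty with rfl | ⟨j, hj⟩
    · exact ⟨fun _ _ => 0, isPlan_zero ((sum_eq_zero_iff_of_nonneg hs).1 (by simpa using hsum))
        (by simp), by omega⟩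
    rcases le_total (s i) (t j) with h | h
    · obtain ⟨x, hx, hv⟩ := ih (A.erase i) B s (Function.update t j (t j - s i))
        (by rw [card_erase_of_mem hi]; have := card_pos.2 ⟨i, hi⟩; omega)
        (fun k hk => hs k (mem_of_mem_erase hk))
        (fun k hk => by
          by_cases hkj : k = j
          · subst hkj; simpa using h
          · simpa [hkj] using ht k hk)
        (by
          rw [sum_update_of_mem hj, sdiff_singleton_eq_erase]
          rw [← add_sum_erase A _ hi, ← add_sum_erase B _ hj] at hsum
          linarith)
      obtain ⟨y, hy, hyv⟩ := exists_isPlan_of_erase hi hj (hs i hi) hx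
      exact ⟨y, hy, by omega⟩
    · obtain ⟨x, hx, hv⟩ := ih A (B.erase j) (Function.update s i (s i - t j)) t
        (by rw [card_erase_of_mem hj]; have := card_pos.2 ⟨j, hj⟩; omega)
        (fun k hk => by
          by_cases hki : k = i
          · subst hki; simpa using h
          · simpa [hki] using hs k hk)
        (fun k hk => ht k (mem_of_mem_erase hk))
        (by
          rw [sum_update_of_mem hi, sdiff_singleton_eq_erase]
          rw [← add_sum_erase A _ hi, ← add_sum_erase B _ hj] at hsum
          linarith)
      obtain ⟨y, hy, hyv⟩ := exists_isPlan_of_erase hj hi (ht j hj) hx.swap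
      rw [value_swap x] at hyv
      refine ⟨fun i j => y j i, hy.swap, ?_⟩
      rw [value_swap]
      omega

/-! ### Solutions and balanced labellings -/

variable {I : PCFCT S T}

theorem sum_toBox_a (f : S ⊕ T → ℕ) (k : ℕ) :
    ∑ v with f v = k, I.toBox.a v = ∑ i with f (.inl i) = k, I.s i := by
  simp [sum_filter, toBox]

theorem sum_toBox_b (f : S ⊕ T → ℕ) (k : ℕ) :
    ∑ v with f v = k, I.toBox.b v = ∑ j with f (.inr j) = k, I.t j := by
  simp [sum_filter, toBox]

/-- The balance condition for the converted instance: supplies and demands of a class agree. -/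
theorem isBalanced_toBox_iff {f : S ⊕ T → ℕ} : I.toBox.IsBalanced f ↔
    ∀ k, ∑ i with f (.inl i) = k, I.s i = ∑ j with f (.inr j) = k, I.t j := by
  simp only [BoxInstance.IsBalanced, sum_toBox_a, sum_toBox_b]

theorem card_filter_sum (f : S ⊕ T → ℕ) (k : ℕ) :
    (univ.filter fun i : S => f (.inl i) = k).card + (univ.filter fun j : T => f (.inr j) = k).card
      = (univ.filter fun v => f v = k).card := by
  simp only [card_filter, Fintype.sum_sum_type]

/-- Solving the classes of a balanced labelling separately gives a solution that uses one pair less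
than there are places for each class. -/
theorem exists_isSolution_of_isBalanced {f : S ⊕ T → ℕ} (hf : I.toBox.IsBalanced f) :
    ∃ x, I.IsSolution x ∧
      value x + (univ.image f).card ≤ Fintype.card S + Fintype.card T := by
  classical
  rw [isBalanced_toBox_iff] at hf
  have hpos : ∀ k ∈ univ.image f, 0 < (univ.filter fun v => f v = k).card := by
    intro k hk
    obtain ⟨v, -, hv⟩ := mem_image.1 hk
    exact card_pos.2 ⟨v, mem_filter.2 ⟨mem_univ v, hv⟩⟩
  have key : ∀ k, ∃ x, k ∈ univ.image f →
      IsPlan (univ.filter fun i : S => f (.inl i) = k) (univ.filter fun j : T => f (.inr j) = k)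
        (fun i => I.s i) (fun j => I.t j) x ∧
      value x + 1 ≤ (univ.filter fun v => f v = k).card := by
    intro k
    by_cases hk : k ∈ univ.image f
    · obtain ⟨x, hx⟩ := exists_isPlan ((univ.filter fun v => f v = k).card - 1)
        (univ.filter fun i : S => f (.inl i) = k) (univ.filter fun j : T => f (.inr j) = k)
        (fun i => I.s i) (fun j => I.t j)
        (by rw [card_filter_sum]; have := hpos k hk; omega)
        (fun _ _ => Nat.cast_nonneg _) (fun _ _ => Nat.cast_nonneg _) (by exact_mod_cast hf k)
      exact ⟨x, fun _ => ⟨hx.1, by have := hpos k hk; have := hx.2; omega⟩⟩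
    · exact ⟨fun _ _ => 0, fun h => absurd h hk⟩
  choose x hx using key
  have himg : ∀ v, f v ∈ univ.image f := fun v => mem_image_of_mem f (mem_univ v)
  -- Both labels may be used to select the plan: off its class a plan vanishes.
  have heq : ∀ i j, x (f (.inl i)) i j = x (f (.inr j)) i j := by
    intro i j
    by_cases h : f (.inl i) = f (.inr j)
    · rw [h]
    · have h1 : x (f (.inl i)) i j = 0 := by
        by_contra h'
        have := ((hx _ (himg _)).1.mem i j h').2
        exact h (mem_filter.1 this).2.symm
      have h2 : x (f (.inr j)) i j = 0 := by
        by_contra h'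
        have := ((hx _ (himg _)).1.mem i j h').1
        exact h (mem_filter.1 this).2
      rw [h1, h2]
  refine ⟨fun i j => x (f (.inl i)) i j, ⟨fun i j => (hx _ (himg _)).1.nonneg i j,
    fun i => (hx _ (himg _)).1.supply i (by simp), fun j => ?_⟩, ?_⟩
  · simp only [heq]
    exact (hx _ (himg _)).1.demand j (by simp)
  · have h1 : value (fun i j => x (f (.inl i)) i j) ≤ ∑ k ∈ univ.image f, value (x k) := by
      refine le_trans ?_
        (set_ncard_biUnion_le (univ.image f) fun k => {p : S × T | 0 < x k p.1 p.2})
      exact Set.ncard_le_ncard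
        (fun p hp => Set.mem_biUnion (mem_coe.2 (himg (.inl p.1))) hp) (Set.toFinite _)
    have h2 : ∑ k ∈ univ.image f, (value (x k) + 1) ≤
        ∑ k ∈ univ.image f, (univ.filter fun v => f v = k).card :=
      sum_le_sum fun k hk => (hx k hk).2
    rw [← card_eq_sum_card_image f univ, card_univ, Fintype.card_sum, sum_add_distrib,
      sum_const, smul_eq_mul, mul_one] at h2
    omega

/-- Merging the two ends of every pair used by a solution gives a balanced labelling. -/
theorem IsSolution.exists_isBalanced {x : S → T → ℝ} (hx : I.IsSolution x) :
    ∃ f, I.toBox.IsBalanced f ∧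
      Fintype.card S + Fintype.card T ≤ (univ.image f).card + value x := by
  classical
  obtain ⟨f, hf, hc⟩ := exists_labelling_of_pairs
    (((univ.filter fun p : S × T => 0 < x p.1 p.2).toList).map
      fun p => ((Sum.inl p.1, Sum.inr p.2) : (S ⊕ T) × (S ⊕ T)))
  have hlabel : ∀ i j, 0 < x i j → f (.inl i) = f (.inr j) := fun i j h =>
    hf (.inl i, .inr j) (List.mem_map.2 ⟨(i, j), by simpa using h, rfl⟩)
  refine ⟨f, isBalanced_toBox_iff.2 fun k => ?_, ?_⟩
  · have h : ∑ i with f (.inl i) = k, (I.s i : ℝ) = ∑ j with f (.inr j) = k, (I.t j : ℝ) := by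
      simp only [← hx.supply, ← hx.demand]
      have h1 : ∀ i j, (if f (.inl i) = k then x i j else 0) =
          if f (.inr j) = k then x i j else 0 := by
        intro i j
        rcases (hx.nonneg i j).eq_or_lt with h0 | h0
        · simp [← h0]
        · rw [hlabel i j h0]
      rw [sum_comm' (t' := univ) (s' := fun _ => univ.filter fun i => f (.inl i) = k) (by simp),
        sum_filter]
      refine sum_congr rfl fun j _ => ?_
      rw [sum_filter, sum_congr rfl fun i _ => h1 i j]
      split_ifs <;> simp
    exact_mod_cast h
  · rw [Fintype.card_sum, List.length_map, length_toList] at hc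
    rwa [value, Set.ncard_eq_toFinset_card', Set.toFinset_ofPred]

/-! ### Same-sum partitions and balanced labellings -/

/-- If all supplies and demands are positive, every class of a balanced labelling meets both `S` and
`T`, so the classes form a same-sum partition. -/
theorem exists_isSameSumPartition_of_isBalanced (hs : ∀ i, 0 < I.s i) (ht : ∀ j, 0 < I.t j)
    {f : S ⊕ T → ℕ} (hf : I.toBox.IsBalanced f) :
    ∃ (A : Fin (univ.image f).card → Finset S) (B : Fin (univ.image f).card → Finset T),
      I.IsSameSumPartition A B := by
  rw [isBalanced_toBox_iff] at hf
  let g := (univ.image f).equivFin.symm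
  have himg : ∀ v, f v ∈ univ.image f := fun v => mem_image_of_mem f (mem_univ v)
  have huniq : ∀ v, ∃! l, f v = g l := fun v =>
    ⟨g.symm ⟨f v, himg v⟩, by simp, fun l hl => by
      rw [Equiv.eq_symm_apply]; exact Subtype.ext hl.symm⟩
  have hiff : ∀ k, (univ.filter fun i => f (.inl i) = k).Nonempty ↔
      (univ.filter fun j => f (.inr j) = k).Nonempty := by
    intro k
    constructor <;> intro h
    · have h1 := sum_pos (fun i _ => hs i) h
      rw [hf k] at h1
      exact nonempty_of_sum_ne_zero h1.ne'
    · have h1 := sum_pos (fun j _ => ht j) h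
      rw [← hf k] at h1
      exact nonempty_of_sum_ne_zero h1.ne'
  have hne : ∀ l, (univ.filter fun i => f (.inl i) = g l).Nonempty := by
    intro l
    obtain ⟨v, -, hv⟩ := mem_image.1 (g l).2
    rcases v with i | j
    · exact ⟨i, by simpa using hv⟩
    · exact (hiff _).2 ⟨j, by simpa using hv⟩
  exact ⟨fun l => univ.filter fun i => f (.inl i) = g l,
    fun l => univ.filter fun j => f (.inr j) = g l,
    ⟨hne, fun l => (hiff _).1 (hne l), fun i => by simpa using huniq (.inl i),
      fun j => by simpa using huniq (.inr j), fun l => hf _⟩⟩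

theorem IsSameSumPartition.exists_isBalanced {m : ℕ} {A : Fin m → Finset S}
    {B : Fin m → Finset T} (h : I.IsSameSumPartition A B) :
    ∃ f, I.toBox.IsBalanced f ∧ (univ.image f).card = m := by
  classical
  choose g hg hg' using h.partition_left
  choose g' hh hh' using h.partition_right
  have hA : ∀ i l, i ∈ A l ↔ g i = l := fun i l => ⟨fun hi => (hg' i l hi).symm, fun e => e ▸ hg i⟩
  have hB : ∀ j l, j ∈ B l ↔ g' j = l := fun j l => ⟨fun hj => (hh' j l hj).symm, fun e => e ▸ hh j⟩
  have hfA : ∀ l, (univ.filter fun i => g i = l) = A l := fun l => by ext i; simp [hA]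
  have hfB : ∀ l, (univ.filter fun j => g' j = l) = B l := fun l => by ext j; simp [hB]
  refine ⟨fun v => (Sum.elim g g' v : Fin m), isBalanced_toBox_iff.2 fun k => ?_, ?_⟩
  · by_cases hk : k < m
    · have := h.sum_eq ⟨k, hk⟩
      rw [← hfA, ← hfB] at this
      change ∑ i with (g i : ℕ) = k, I.s i = ∑ j with (g' j : ℕ) = k, I.t j
      simpa only [Fin.ext_iff] using this
    · have h1 : ∀ l : Fin m, (l : ℕ) ≠ k := fun l e => hk (e ▸ l.2)
      simp [h1]
  · have : (univ.image fun v => ((Sum.elim g g' v : Fin m) : ℕ)) =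
        univ.image (Fin.val : Fin m → ℕ) := by
      ext k
      simp only [mem_image, mem_univ, true_and]
      constructor
      · rintro ⟨v, rfl⟩
        exact ⟨_, rfl⟩
      · rintro ⟨l, rfl⟩
        obtain ⟨i, hi⟩ := h.nonempty_left l
        exact ⟨.inl i, congrArg Fin.val ((hA i l).1 hi)⟩
    rw [this, card_image_of_injective _ Fin.val_injective, card_univ, Fintype.card_fin]

end PCFCT

theorem mainTheorem6 {S T : Type*} [Fintype S] [Fintype T] (I : PCFCT S T) :
    ∃ d : ℕ,
      I.IsOptimalValue d ∧
      I.toBox.skeleton.Reachable I.toBox.source I.toBox.target ∧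
      I.toBox.skeleton.dist I.toBox.source I.toBox.target = d ∧
      ((∀ i, 0 < I.s i) → (∀ j, 0 < I.t j) →
        ∃ m : ℕ, I.IsMaxPartitionSize m ∧ m ≤ Fintype.card S + Fintype.card T ∧
          d = Fintype.card S + Fintype.card T - m) := by
  obtain ⟨M, ⟨f, hf, rfl⟩, hmax⟩ := I.toBox.exists_isGreatest_card_image
  have hle : (univ.image f).card ≤ Fintype.card S + Fintype.card T := by
    simpa using card_image_le (s := univ) (f := f)
  refine ⟨Fintype.card S + Fintype.card T - (univ.image f).card, ⟨?_, ?_⟩, ?_, ?_,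
    fun hs ht => ⟨_, ⟨?_, ?_⟩, hle, rfl⟩⟩
  · obtain ⟨x, hx, hv⟩ := PCFCT.exists_isSolution_of_isBalanced hf
    obtain ⟨g, hg, hc⟩ := hx.exists_isBalanced
    have := hmax ⟨g, hg, rfl⟩
    exact ⟨x, hx, by omega⟩
  · rintro _ ⟨x, hx, rfl⟩
    obtain ⟨g, hg, hc⟩ := hx.exists_isBalanced
    have := hmax ⟨g, hg, rfl⟩
    omega
  · exact hf.exists_walk.choose.reachable
  · obtain ⟨p, hp⟩ := hf.exists_walk
    obtain ⟨q, hq⟩ := p.reachable.exists_walk_length_eq_dist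
    obtain ⟨g, hg, hc⟩ := I.toBox.exists_isBalanced_of_walk q
    have h1 := hmax ⟨g, hg, rfl⟩
    have h2 := SimpleGraph.dist_le p
    rw [Fintype.card_sum] at hp hc
    omega
  · exact PCFCT.exists_isSameSumPartition_of_isBalanced hs ht hf
  · rintro k ⟨A, B, h⟩
    exact hmax h.exists_isBalanced
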